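/- Equip $[0,1]^{\mathbb Z}$ with the product topology and let $\sigma$ be the shift, $\sigma((x_i)_{i\in\mathbb Z})=(x_{i+1})_{i\in\mathbb Z}$. A subshift is a closed set $\mathcal S\subset[0,1]^{\mathbb Z}$ with $\sigma(\mathcal S)=\mathcal S$; $\mathcal P_\sigma(\mathcal S)$ denotes the set of $\sigma$-invariant Borel probability measures on $\mathcal S$, and $\pi_n(x)=(x_0,\dots,x_{n-1})\in[0,1]^n$. All cubes $[0,1]^n$ carry the distance induced by $\|\cdot\|_\infty$. For $A\subset[0,1]^n$ and $\varepsilon>0$ let $\#(A,\varepsilon)$ be the minimal cardinality of a cover of $A$ by open sets of diameter smaller than $\varepsilon$, and let $\overline{\dim}_B(A)=\limsup_{\varepsilon\to0^+}\frac{\log\#(A,\varepsilon)}{\log(1/\varepsilon)}$ be the upper box dimension (with $\overline{\dim}_B(\emptyset)=0$). For $\mu\in\mathcal P_\sigma(\mathcal S)$ and $\delta\ge0$, the measurable mean box dimension is $$R_B(\mu,\delta)=\limsup_{n\to\infty}\ \inf\Big\{\tfrac{\overline{\dim}_B(A)}{n}: A\subset[0,1]^n \text{ compact},\ \mu(\pi_n^{-1}(A))\ge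 1-\delta\Big\}.$$ For $0<\alpha<1$, $\varepsilon\ge0$ and $n\in\mathbb N$ let $r_{\mathrm{LIN}-\mathcal H_\alpha}(\mu,\varepsilon,n)$ be the infimum of $\frac kn$ over all natural numbers $k$ for which there exist a map $f:[0,1]^n\to[0,1]^k$ that is the restriction of a linear map $\mathbb R^n\to\mathbb R^k$, and an $\alpha$-Hölder map $g:[0,1]^k\to[0,1]^n$ (with any finite Hölder constant), such that $$\mu\big(\{x\in\mathcal S:\ g(f(\pi_n(x)))\ne\pi_n(x)\}\big)\le\varepsilon,$$ and let $r_{\mathrm{LIN}-\mathcal H_\alpha}(\mu,\varepsilon)=\limsup_{n\to\infty}r_{\mathrm{LIN}-\mathcal H_\alpha}(\mu,\varepsilon,n)$. Theorem. Let $\mathcal S\subset[0,1]^{\mathbb Z}$ be a subshift. Then for every $0<\alpha<1$, $$\alpha\,\sup_{\varepsilon>0}\ \sup_{\mu\in\mathcal P_\sigma(\mathcal S)}R_B(\mu,\varepsilon)\ \le\ \sup_{\varepsilon>0}\ \sup_{\mu\in\mathcal P_\sigma(\mathcal S)}r_{\mathrm{LIN}-\mathcal H_\alpha}(\mu,\varepsilon)\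 \le\ \frac1{1-\alpha}\,\sup_{\varepsilon>0}\ \sup_{\mu\in\mathcal P_\sigma(\mathcal S)}R_B(\mu,\varepsilon).$$ (For $\mathcal S=\emptyset$ all suprema are read as $0$.) -/

import Mathlib

open Filter Topology MeasureTheory
open scoped NNReal ENNReal unitInterval

noncomputable section

namespace AnalogCompression

/-- The unit cube `[0,1]^n`; its Mathlib metric is the one induced by the sup norm. -/
abbrev Cube (n : ℕ) : Type := Fin n → I

/-- The space `[0,1]^ℤ` with the product topology and its Borel (= product) σ-algebra. -/
abbrev Traj : Type := ℤ → I

/-- The shift `(x_i) ↦ (x_{i+1})` on `[0,1]^ℤ`. -/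
def shift (x : Traj) : Traj := fun i => x (i + 1)

/-- The block `(x_0, …, x_{n-1})` of a bi-infinite sequence. -/
def block (n : ℕ) (x : Traj) : Cube n := fun i => x (i.val : ℤ)

/-- A subshift: a closed, shift-invariant subset of `[0,1]^ℤ`. -/
def IsSubshift (S : Set Traj) : Prop := IsClosed S ∧ shift '' S = S

/-- The shift-invariant Borel probability measures on `S`, regarded as measures on `[0,1]^ℤ`
that give full mass to `S`. -/
def invariantMeasures (S : Set Traj) : Set (Measure Traj) :=
  {μ | IsProbabilityMeasure μ ∧ μ S = 1 ∧ μ.map shift = μ}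

/-- The minimal cardinality of a cover of `A` by open sets of diameter smaller than `ε`
(finite because the ambient metric space is compact). -/
def coveringNumber {X : Type*} [MetricSpace X] [CompactSpace X] (A : Set X) (ε : ℝ) : ℕ :=
  sInf {N : ℕ | ∃ U : Fin N → Set X,
    (∀ i, IsOpen (U i) ∧ Metric.diam (U i) < ε) ∧ A ⊆ ⋃ i, U i}

/-- The upper box (Minkowski) dimension. The quotient is nonnegative for `0 < ε < 1`, so that
nothing is lost in passing to `ℝ≥0∞`; the empty set gets dimension `0`. -/
def upperBoxDim {X : Type*} [MetricSpace X] [CompactSpace X] (A : Set X) : ℝ≥0∞ :=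
  limsup (fun ε : ℝ => ENNReal.ofReal (Real.log (coveringNumber A ε) / Real.log (1 / ε)))
    (𝓝[>] (0 : ℝ))

/-- The measurable mean box dimension `R_B(μ, δ)`. -/
def measurableMeanBoxDim (μ : Measure Traj) (δ : ℝ≥0) : ℝ≥0∞ :=
  limsup (fun n : ℕ =>
    ⨅ (A : Set (Cube n)) (_ : IsCompact A ∧ 1 - (δ : ℝ≥0∞) ≤ μ (block n ⁻¹' A)),
      upperBoxDim A / (n : ℝ≥0∞)) atTop

/-- A regularity class: a set of functions between finite-dimensional unit cubes. -/
abbrev RegularityClass : Type := (n k : ℕ) → Set (Cube n → Cube k)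

/-- The class of linear maps: restrictions to the cube of linear maps `ℝ^n → ℝ^k`. -/
def LIN : RegularityClass := fun n k =>
  {f | ∃ T : (Fin n → ℝ) →ₗ[ℝ] (Fin k → ℝ),
    ∀ x : Cube n, (fun j => (f x j : ℝ)) = T (fun i => (x i : ℝ))}

/-- The class of `α`-Hölder maps (with some constant depending on the map), with respect to
the sup norm distances. -/
def Hoelder (α : ℝ≥0) : RegularityClass := fun _ _ =>
  {g | ∃ L : ℝ≥0, HolderWith L α g}

/-- The almost lossless analog compression rate of `μ` with `n`-block error probability `ε`,
for compressors in `C` and decompressors in `D`. -/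
def blockCompressionRate (C D : RegularityClass) (S : Set Traj) (μ : Measure Traj)
    (ε : ℝ≥0) (n : ℕ) : ℝ≥0∞ :=
  ⨅ (k : ℕ) (_ : ∃ f ∈ C n k, ∃ g ∈ D k n,
    μ {x | x ∈ S ∧ g (f (block n x)) ≠ block n x} ≤ (ε : ℝ≥0∞)), (k : ℝ≥0∞) / (n : ℝ≥0∞)

/-- The almost lossless analog compression rate of `μ` with error probability `ε`. -/
def compressionRate (C D : RegularityClass) (S : Set Traj) (μ : Measure Traj)
    (ε : ℝ≥0) : ℝ≥0∞ :=
  limsup (fun n : ℕ => blockCompressionRate C D S μ ε n) atTop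

end AnalogCompression

end

/-! Both inequalities are proved measure by measure. Lower bound: a code with an `α`-Hölder
decompressor `g` recovers blocks inside the compact set `Set.range g`, whose box dimension is at
most `k / α` (`upperBoxDim_range_le_of_holderWith`). That set therefore competes in the infimum
defining `measurableMeanBoxDim`.

Upper bound: let a compact `A` carry most of the mass, with `upperBoxDim A < d < (1 - α) * k`. Draw
a `k × n` matrix `L` with independent uniform entries. For fixed `x`, a union bound over dyadic
shells around `x` shows that `|Lx - Ly| ≥ c * |x - y| ^ (1/α)` for all `y ∈ A`, outside an event
whose probability is small for small `c` (`exists_uniformMatrix_bad_le`). Fubini then yields one `L`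
that works for most `x` (`exists_linear_holder_code`). On these points `L` has an `α`-Hölder
inverse, which extends to the cube (`exists_holderWith_leftInverse`). Taking `k` just above `dim A /
(1 - α)` gives the factor `1 / (1 - α)`. -/

namespace AnalogCompression

/-! ### Covering numbers and box dimension -/

section Covering

variable {X : Type*} [MetricSpace X] [CompactSpace X]

theorem coveringNumber_le_card {ι : Type*} [Fintype ι] {A : Set X} {ε : ℝ} (U : ι → Set X)
    (hU : ∀ i, IsOpen (U i) ∧ Metric.diam (U i) < ε) (hA : A ⊆ ⋃ i, U i) :
    coveringNumber A ε ≤ Fintype.card ι := by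
  refine Nat.sInf_le ⟨fun i => U ((Fintype.equivFin ι).symm i), fun i => hU _, fun x hx => ?_⟩
  obtain ⟨i, hi⟩ := Set.mem_iUnion.1 (hA hx)
  exact Set.mem_iUnion.2 ⟨Fintype.equivFin ι i, by simpa using hi⟩

theorem coveringNumber_le_card_of_net {ι : Type*} [Fintype ι] {A : Set X} {r ε : ℝ} (hr : 0 ≤ r)
    (hrε : 2 * r < ε) (p : ι → X) (hA : ∀ x ∈ A, ∃ i, dist x (p i) < r) :
    coveringNumber A ε ≤ Fintype.card ι :=
  coveringNumber_le_card (fun i => Metric.ball (p i) r)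
    (fun _ => ⟨Metric.isOpen_ball, (Metric.diam_ball hr).trans_lt hrε⟩)
    (fun x hx => Set.mem_iUnion.2 (hA x hx))

theorem exists_minimal_cover (A : Set X) {ε : ℝ} (hε : 0 < ε) :
    ∃ U : Fin (coveringNumber A ε) → Set X,
      (∀ i, IsOpen (U i) ∧ Metric.diam (U i) < ε) ∧ A ⊆ ⋃ i, U i := by
  refine Nat.sInf_mem (s := {N : ℕ | ∃ U : Fin N → Set X,
    (∀ i, IsOpen (U i) ∧ Metric.diam (U i) < ε) ∧ A ⊆ ⋃ i, U i}) ?_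
  -- A finite cover must exist: `sInf ∅ = 0` on `ℕ` would be a spurious value.
  obtain ⟨t, -, ht, hcov⟩ := finite_cover_balls_of_compact (isCompact_univ (X := X))
    (show 0 < ε / 3 by positivity)
  have := ht.fintype
  refine ⟨Fintype.card t, fun i => Metric.ball ((Fintype.equivFin t).symm i : X) (ε / 3),
    fun i => ⟨Metric.isOpen_ball, (Metric.diam_ball (by positivity)).trans_lt (by linarith)⟩,
    fun x _ => ?_⟩
  obtain ⟨y, hy, hxy⟩ := Set.mem_iUnion₂.1 (hcov (Set.mem_univ x))
  exact Set.mem_iUnion.2 ⟨Fintype.equivFin t ⟨y, hy⟩, by simpa using hxy⟩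

theorem coveringNumber_le_rpow_of_upperBoxDim_lt {A : Set X} {d : ℝ≥0}
    (h : upperBoxDim A < d) :
    ∃ ε₀ : ℝ, 0 < ε₀ ∧ ∀ ε : ℝ, 0 < ε → ε < ε₀ → (coveringNumber A ε : ℝ) ≤ ε ^ (-(d : ℝ)) := by
  have h1 := eventually_lt_of_limsup_lt h
  have h2 : ∀ᶠ ε : ℝ in 𝓝[>] 0, ε < 1 := nhdsWithin_le_nhds (eventually_lt_nhds one_pos)
  have h3 : ∀ᶠ ε : ℝ in 𝓝[>] 0, (coveringNumber A ε : ℝ) ≤ ε ^ (-(d : ℝ)) := by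
    filter_upwards [h1, h2, self_mem_nhdsWithin] with ε h1 h2 (h3 : 0 < ε)
    have hl : 0 < Real.log (1 / ε) := Real.log_pos (by rw [lt_div_iff₀ h3]; linarith)
    rw [← ENNReal.ofReal_coe_nnreal, ENNReal.ofReal_lt_ofReal_iff', div_lt_iff₀ hl] at h1
    replace h1 := h1.1
    rcases Nat.eq_zero_or_pos (coveringNumber A ε) with h0 | h0
    · rw [h0]; simpa using Real.rpow_nonneg h3.le _
    · rw [Real.le_rpow_iff_log_le (by exact_mod_cast h0) h3]
      rw [one_div, Real.log_inv] at h1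
      linarith
  obtain ⟨ε₀, hε₀, h⟩ := mem_nhdsGT_iff_exists_Ioo_subset.1 h3
  exact ⟨ε₀, hε₀, fun ε h1 h2 => h ⟨h1, h2⟩⟩

end Covering

/-! ### Hölder images of cubes and the lower bound -/

theorem exists_grid_net (k : ℕ) {m : ℕ} (hm : 0 < m) :
    ∃ p : (Fin k → Fin (m + 1)) → Cube k, ∀ x, ∃ i, dist x (p i) ≤ 1 / m := by
  have hm' : (0 : ℝ) < m := by exact_mod_cast hm
  refine ⟨fun i j => ⟨(i j : ℕ) / m, by positivity, ?_⟩, fun x => ?_⟩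
  · rw [div_le_one hm']
    exact_mod_cast Nat.lt_succ_iff.1 (i j).2
  · have hx (j) : 0 ≤ (x j : ℝ) * m := mul_nonneg (x j).2.1 hm'.le
    refine ⟨fun j => ⟨⌊(x j : ℝ) * m⌋₊, ?_⟩, ?_⟩
    · refine Nat.lt_succ_iff.2 (Nat.floor_le_of_le ?_)
      nlinarith [(x j).2.2]
    · refine (dist_pi_le_iff (by positivity)).2 fun j => ?_
      rw [Subtype.dist_eq, Real.dist_eq]
      have h1 := Nat.floor_le (hx j)
      have h2 := Nat.lt_floor_add_one ((x j : ℝ) * m)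
      have h3 : (x j : ℝ) - (⌊(x j : ℝ) * m⌋₊ : ℝ) / m
          = ((x j : ℝ) * m - ⌊(x j : ℝ) * m⌋₊) / m := by field_simp
      simp only
      rw [h3, abs_of_nonneg (div_nonneg (by linarith) hm'.le)]
      gcongr
      linarith

theorem coveringNumber_range_le_of_holderWith {X : Type*} [MetricSpace X] [CompactSpace X] {k : ℕ}
    {α L : ℝ≥0} (hα : 0 < α) {g : Cube k → X} (hg : HolderWith L α g) {ε : ℝ} (h0 : 0 < ε)
    (h1 : ε < 1) :
    (coveringNumber (Set.range g) ε : ℝ)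
      ≤ (3 * (4 * ((L : ℝ) + 1) / ε) ^ (1 / (α : ℝ))) ^ k := by
  have hα' : (0 : ℝ) < α := hα
  have hL : (0 : ℝ) ≤ L := L.2
  -- Mesh `B ^ (-1/α)` makes images of grid cells smaller than `ε / 3`; the `+ 1` keeps `B ≥ 1` even
  -- when `L = 0`.
  set B : ℝ := 4 * ((L : ℝ) + 1) / ε with hB
  have hB1 : 1 ≤ B := by rw [hB, le_div_iff₀ h0]; linarith
  set m := ⌈B ^ (1 / (α : ℝ))⌉₊ with hm
  have hC1 : 1 ≤ B ^ (1 / (α : ℝ)) := Real.one_le_rpow hB1 (by positivity)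
  have hmpos : 0 < m := Nat.ceil_pos.2 (by linarith)
  obtain ⟨p, hp⟩ := exists_grid_net k hmpos
  have hN : coveringNumber (Set.range g) ε ≤ Fintype.card (Fin k → Fin (m + 1)) := by
    refine coveringNumber_le_card_of_net (r := ε / 3) (by positivity) (by linarith)
      (fun i => g (p i)) ?_
    rintro _ ⟨x, rfl⟩
    obtain ⟨i, hi⟩ := hp x
    refine ⟨i, ?_⟩
    have hmα : (1 / (m : ℝ)) ^ (α : ℝ) ≤ 1 / B := by
      have : B ≤ (m : ℝ) ^ (α : ℝ) := by
        calc B = (B ^ (1 / (α : ℝ))) ^ (α : ℝ) := by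
              rw [← Real.rpow_mul (by linarith), one_div_mul_cancel hα'.ne', Real.rpow_one]
          _ ≤ _ := Real.rpow_le_rpow (by positivity) (Nat.le_ceil _) hα'.le
      rw [Real.div_rpow zero_le_one (by positivity), Real.one_rpow]
      exact one_div_le_one_div_of_le (by linarith) this
    calc dist (g x) (g (p i)) ≤ L * (1 / (m : ℝ)) ^ (α : ℝ) := hg.dist_le_of_le hi
      _ ≤ L * (1 / B) := by gcongr
      _ < ε / 3 := by
        rw [hB, one_div_div, mul_div_assoc', div_lt_div_iff₀ (by positivity) (by norm_num)]
        nlinarith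
  calc (coveringNumber (Set.range g) ε : ℝ) ≤ ((m + 1 : ℕ) : ℝ) ^ k := by
        have : Fintype.card (Fin k → Fin (m + 1)) = (m + 1) ^ k := by simp
        rw [this] at hN
        exact_mod_cast hN
    _ ≤ _ := by
        gcongr
        have := Nat.ceil_lt_add_one (show 0 ≤ B ^ (1 / (α : ℝ)) by linarith)
        push_cast
        linarith

theorem upperBoxDim_range_le_of_holderWith {X : Type*} [MetricSpace X] [CompactSpace X] {k : ℕ}
    {α L : ℝ≥0} (hα : 0 < α) {g : Cube k → X} (hg : HolderWith L α g) :
    (α : ℝ≥0∞) * upperBoxDim (Set.range g) ≤ k := by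
  have hα' : (0 : ℝ) < α := hα
  have hL : (0 : ℝ) ≤ L := L.2
  set C : ℝ := k * (Real.log 3 + Real.log (4 * ((L : ℝ) + 1)) / α) with hC
  have key : ∀ᶠ ε : ℝ in 𝓝[>] 0,
      Real.log (coveringNumber (Set.range g) ε) / Real.log (1 / ε)
        ≤ C / Real.log (1 / ε) + k / α := by
    filter_upwards [nhdsWithin_le_nhds (eventually_lt_nhds one_pos), self_mem_nhdsWithin]
      with ε h1 (h0 : 0 < ε)
    have hl : 0 < Real.log (1 / ε) := Real.log_pos (by rw [lt_div_iff₀ h0]; linarith)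
    rw [div_le_iff₀ hl, add_mul, div_mul_cancel₀ _ hl.ne']
    have hN := coveringNumber_range_le_of_holderWith hα hg h0 h1
    have hne : (0 : ℝ) < coveringNumber (Set.range g) ε := by
      refine Nat.cast_pos.2 (Nat.pos_of_ne_zero fun h => ?_)
      obtain ⟨U, -, hU⟩ := exists_minimal_cover (Set.range g) h0
      obtain ⟨i, -⟩ := Set.mem_iUnion.1 (hU (Set.mem_range_self 0))
      exact (h ▸ i).elim0
    refine (Real.log_le_log hne hN).trans (le_of_eq ?_)
    have hp : 0 < 4 * ((L : ℝ) + 1) / ε := by positivity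
    rw [Real.log_pow, Real.log_mul (by norm_num) (Real.rpow_pos_of_pos hp _).ne', Real.log_rpow hp,
      div_eq_mul_one_div (4 * ((L : ℝ) + 1)) ε, Real.log_mul (by positivity) (by positivity), hC]
    ring
  have hlim : Tendsto (fun ε : ℝ => ENNReal.ofReal (C / Real.log (1 / ε) + k / α)) (𝓝[>] 0)
      (𝓝 (ENNReal.ofReal (0 + k / α))) := by
    refine ENNReal.tendsto_ofReal (Tendsto.add_const _ (Tendsto.const_div_atTop ?_ _))
    have : (fun ε : ℝ => Real.log (1 / ε)) = fun ε => -Real.log ε := by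
      ext; rw [one_div, Real.log_inv]
    rw [this]
    exact tendsto_neg_atBot_atTop.comp Real.tendsto_log_nhdsGT_zero
  have hle : upperBoxDim (Set.range g) ≤ ENNReal.ofReal (0 + k / α) := by
    rw [← hlim.limsup_eq]
    exact limsup_le_limsup (key.mono fun ε h => ENNReal.ofReal_le_ofReal h)
  calc (α : ℝ≥0∞) * upperBoxDim (Set.range g) ≤ α * ENNReal.ofReal (0 + k / α) := by gcongr
    _ = k := by
      rw [← ENNReal.ofReal_coe_nnreal, ← ENNReal.ofReal_mul hα'.le, zero_add,
        mul_div_cancel₀ _ hα'.ne', ENNReal.ofReal_natCast]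

theorem mul_measurableMeanBoxDim_le_compressionRate {S : Set Traj} {μ : Measure Traj}
    (hμ : μ ∈ invariantMeasures S) {α : ℝ≥0} (hα : 0 < α) (ε : ℝ≥0) (C : RegularityClass) :
    (α : ℝ≥0∞) * measurableMeanBoxDim μ ε ≤ compressionRate C (Hoelder α) S μ ε := by
  rw [measurableMeanBoxDim, ← ENNReal.limsup_const_mul_of_ne_top ENNReal.coe_ne_top]
  refine limsup_le_limsup (Eventually.of_forall fun n => ?_)
  refine le_iInf₂ fun k ⟨f, _, g, ⟨L, hg⟩, hbad⟩ => ?_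
  have hA : IsCompact (Set.range g) ∧ 1 - (ε : ℝ≥0∞) ≤ μ (block n ⁻¹' Set.range g) := by
    refine ⟨isCompact_range (hg.continuous hα), tsub_le_iff_right.2 ?_⟩
    calc 1 = μ S := hμ.2.1.symm
      _ ≤ μ (block n ⁻¹' Set.range g ∪ {x | x ∈ S ∧ g (f (block n x)) ≠ block n x}) := by
        refine measure_mono fun x hx => ?_
        by_cases h : g (f (block n x)) = block n x
        · exact Or.inl ⟨_, h⟩
        · exact Or.inr ⟨hx, h⟩
      _ ≤ _ := (measure_union_le _ _).trans (by gcongr)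
  refine (mul_le_mul_right (iInf₂_le (Set.range g) hA) (α : ℝ≥0∞)).trans ?_
  rw [← mul_div_assoc]
  gcongr
  exact upperBoxDim_range_le_of_holderWith hα hg

/-! ### Small-ball estimates for random matrices -/

/-- Replacing the coordinate `a m` by `z ⬝ᵥ a` is linear with determinant `z m`, and sends the set
into a box of volume `2 * ρ`. -/
theorem volume_slab_inter_unitBox_le {n : ℕ} (z : Fin n → ℝ) {m : Fin n} {r ρ : ℝ} (hr : 0 < r)
    (hm : r ≤ |z m|) (hρ : 0 ≤ ρ) :
    volume ({a : Fin n → ℝ | |z ⬝ᵥ a| ≤ ρ} ∩ Set.Icc 0 1) ≤ ENNReal.ofReal (2 * ρ / r) := by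
  set M : Matrix (Fin n) (Fin n) ℝ := (1 : Matrix (Fin n) (Fin n) ℝ).updateRow m z with hM
  have hdet : M.det = z m := by
    rw [hM, ← Matrix.cramer_transpose_apply, Matrix.transpose_one, Matrix.cramer_one]
    rfl
  have hz : 0 < |z m| := hr.trans_le hm
  set s : Fin n → Set ℝ := Function.update (fun _ => Set.Icc 0 1) m (Set.Icc (-ρ) ρ) with hs
  have hsub : ({a : Fin n → ℝ | |z ⬝ᵥ a| ≤ ρ} ∩ Set.Icc 0 1)
      ⊆ Matrix.toLin' M ⁻¹' (Set.univ.pi s) := by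
    rintro a ⟨ha, ha'⟩ i -
    rw [Matrix.toLin'_apply]
    by_cases hi : i = m
    · subst hi
      simpa [hs, hM, Matrix.mulVec, abs_le] using ha
    · have : M.mulVec a i = a i := by
        simp [hM, Matrix.mulVec, Matrix.updateRow_ne hi]
        exact congrFun (Matrix.one_mulVec a) i
      rw [this, hs, Function.update_of_ne hi]
      exact ⟨ha'.1 i, ha'.2 i⟩
  refine (measure_mono hsub).trans ?_
  rw [Measure.addHaar_preimage_linearMap _ (by
    rw [LinearMap.det_toLin', hdet]; exact abs_pos.1 hz), LinearMap.det_toLin', hdet,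
    volume_pi_pi, ← Finset.mul_prod_erase _ _ (Finset.mem_univ m)]
  have h1 : ∏ i ∈ Finset.univ.erase m, volume (s i) = 1 := by
    refine Finset.prod_eq_one fun i hi => ?_
    rw [hs, Function.update_of_ne (Finset.ne_of_mem_erase hi)]
    simp
  rw [h1, mul_one, hs, Function.update_self, Real.volume_Icc, ← ENNReal.ofReal_mul (abs_nonneg _)]
  refine ENNReal.ofReal_le_ofReal ?_
  rw [abs_inv, ← div_eq_inv_mul]
  calc (ρ - -ρ) / |z m| = 2 * ρ / |z m| := by ring
    _ ≤ _ := by gcongr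

/-- The law of a random `k × n` matrix with independent entries uniform on `[0,1]`. -/
noncomputable def uniformMatrix (n k : ℕ) : Measure (Fin k → Fin n → ℝ) :=
  Measure.pi fun _ => volume.restrict (Set.Icc 0 1)

/-- The product of a matrix, given by its rows, with a point of the cube. -/
noncomputable def matrixApply {n k : ℕ} (L : Fin k → Fin n → ℝ) (x : Cube n) : Fin k → ℝ :=
  fun j => ∑ i, L j i * (x i : ℝ)

theorem continuous_matrixApply {n k : ℕ} :
    Continuous fun p : (Fin k → Fin n → ℝ) × Cube n => matrixApply p.1 p.2 := by
  unfold matrixApply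
  fun_prop

instance isProbabilityMeasure_uniformMatrix (n k : ℕ) :
    IsProbabilityMeasure (uniformMatrix n k) := by
  have : IsProbabilityMeasure ((volume : Measure (Fin n → ℝ)).restrict (Set.Icc 0 1)) :=
    ⟨by simp [Real.volume_Icc_pi]⟩
  unfold uniformMatrix
  infer_instance

theorem uniformMatrix_compl_unitBox (n k : ℕ) : uniformMatrix n k (Set.Icc 0 1)ᶜ = 0 := by
  rw [prob_compl_eq_zero_iff measurableSet_Icc, ← Set.pi_univ_Icc, uniformMatrix, Measure.pi_pi]
  simp [Real.volume_Icc_pi]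

theorem dist_matrixApply_le {n k : ℕ} {L : Fin k → Fin n → ℝ} (hL : L ∈ Set.Icc 0 1)
    (x y : Cube n) : dist (matrixApply L x) (matrixApply L y) ≤ n * dist x y := by
  refine (dist_pi_le_iff (by positivity)).2 fun j => ?_
  rw [Real.dist_eq, matrixApply, matrixApply, ← Finset.sum_sub_distrib]
  calc |∑ i, (L j i * (x i : ℝ) - L j i * (y i : ℝ))|
      ≤ ∑ i, |L j i * (x i : ℝ) - L j i * (y i : ℝ)| := Finset.abs_sum_le_sum_abs _ _
    _ ≤ ∑ _i : Fin n, dist x y := Finset.sum_le_sum fun i _ => by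
        rw [← mul_sub, abs_mul, abs_of_nonneg (hL.1 j i)]
        have h1 : |(x i : ℝ) - y i| ≤ dist x y := dist_le_pi_dist x y i
        exact (mul_le_of_le_one_left (abs_nonneg _) (hL.2 j i)).trans h1
    _ = n * dist x y := by simp

/-- In the sup norm each of the `k` independent rows must fall in the same slab, hence the `k`-th
power. -/
theorem uniformMatrix_dist_le {n k : ℕ} {x y : Cube n} {r ρ : ℝ} (hr : 0 < r) (hρ : 0 ≤ ρ)
    (hxy : r ≤ dist x y) :
    uniformMatrix n k {L | dist (matrixApply L x) (matrixApply L y) ≤ ρ}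
      ≤ ENNReal.ofReal (2 * ρ / r) ^ k := by
  obtain ⟨m, hm⟩ : ∃ m, r ≤ |(x m : ℝ) - y m| := by
    by_contra! h
    exact absurd hxy (not_le.2 ((dist_pi_lt_iff hr).2 h))
  set z : Fin n → ℝ := fun i => (x i : ℝ) - y i with hz
  have hset : {L : Fin k → Fin n → ℝ | dist (matrixApply L x) (matrixApply L y) ≤ ρ}
      = Set.univ.pi fun _ => {a : Fin n → ℝ | |z ⬝ᵥ a| ≤ ρ} := by
    ext L
    have hj (j : Fin k) : matrixApply L x j - matrixApply L y j = z ⬝ᵥ L j := by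
      simp only [matrixApply, hz, dotProduct, ← Finset.sum_sub_distrib]
      exact Finset.sum_congr rfl fun _ _ => by ring
    simp [dist_pi_le_iff hρ, Real.dist_eq, hj]
  rw [hset, uniformMatrix, Measure.pi_pi]
  refine (Finset.prod_le_prod' fun j _ => ?_).trans (b := ∏ _j : Fin k, ENNReal.ofReal (2 * ρ / r))
    (by simp)
  rw [Measure.restrict_apply' measurableSet_Icc]
  exact volume_slab_inter_unitBox_le z hr hm hρ

/-- Union bound over a minimal cover of `A`. Within one piece, matrices in the unit box are
`n`-Lipschitz, so a single far point represents the piece once `η` is enlarged to `(n + 1) * η`. -/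
theorem uniformMatrix_shell_le {n k : ℕ} (A : Set (Cube n)) (x : Cube n) {r η : ℝ} (hr : 0 < r)
    (hη : 0 < η) :
    uniformMatrix n k {L | L ∈ Set.Icc 0 1 ∧
        ∃ y ∈ A, r ≤ dist x y ∧ dist (matrixApply L x) (matrixApply L y) < η}
      ≤ coveringNumber A η * ENNReal.ofReal (2 * ((n + 1) * η) / r) ^ k := by
  obtain ⟨U, hU, hA⟩ := exists_minimal_cover A hη
  set E : Fin (coveringNumber A η) → Set (Fin k → Fin n → ℝ) := fun i =>
    {L | L ∈ Set.Icc 0 1 ∧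
      ∃ y ∈ U i, r ≤ dist x y ∧ dist (matrixApply L x) (matrixApply L y) < η} with hE
  have hsub : {L : Fin k → Fin n → ℝ | L ∈ Set.Icc 0 1 ∧
        ∃ y ∈ A, r ≤ dist x y ∧ dist (matrixApply L x) (matrixApply L y) < η} ⊆ ⋃ i, E i := by
    rintro L ⟨hL, y, hy, h⟩
    obtain ⟨i, hi⟩ := Set.mem_iUnion.1 (hA hy)
    exact Set.mem_iUnion.2 ⟨i, hL, y, hi, h⟩
  have hEi (i) : uniformMatrix n k (E i) ≤ ENNReal.ofReal (2 * ((n + 1) * η) / r) ^ k := by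
    by_cases h : ∃ y ∈ U i, r ≤ dist x y
    · obtain ⟨y, hy, hxy⟩ := h
      refine (measure_mono ?_).trans (uniformMatrix_dist_le (ρ := (n + 1) * η) hr (by positivity) hxy)
      rintro L ⟨hL, w, hw, -, hlt⟩
      have h1 : dist w y ≤ η :=
        (Metric.dist_le_diam_of_mem (Metric.isBounded_of_compactSpace) hw hy).trans (hU i).2.le
      have h2 := dist_matrixApply_le hL w y
      have h3 := dist_triangle (matrixApply L x) (matrixApply L w) (matrixApply L y)
      have h4 : (n : ℝ) * dist w y ≤ n * η := by gcongr
      show dist _ _ ≤ _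
      linarith
    · have : E i = ∅ := by
        refine Set.eq_empty_of_forall_notMem fun L hL => h ?_
        obtain ⟨-, y, hy, hxy, -⟩ := hL
        exact ⟨y, hy, hxy⟩
      rw [this]; simp
  calc _ ≤ uniformMatrix n k (⋃ i, E i) := measure_mono hsub
    _ ≤ ∑ i, uniformMatrix n k (E i) := measure_iUnion_fintype_le _ _
    _ ≤ ∑ _i : Fin (coveringNumber A η), ENNReal.ofReal (2 * ((n + 1) * η) / r) ^ k :=
        Finset.sum_le_sum fun i _ => hEi i
    _ = _ := by simp

theorem shell_bound_eq {d β c : ℝ} (n k j : ℕ) (hc : 0 < c) :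
    (c * ((1 / 2 : ℝ) ^ j) ^ β) ^ (-d)
        * (2 * ((n + 1) * (c * ((1 / 2 : ℝ) ^ j) ^ β)) / (1 / 2) ^ (j + 1)) ^ k
      = (4 * ((n : ℝ) + 1)) ^ k * c ^ (k - d) * ((1 / 2 : ℝ) ^ ((β - 1) * k - β * d)) ^ j := by
  set h : ℝ := (1 / 2 : ℝ) ^ j with hh
  have hpos : 0 < h := by positivity
  have e1 : ((1 / 2 : ℝ) ^ ((β - 1) * k - β * d)) ^ j = h ^ ((β - 1) * k - β * d) := by
    rw [hh, ← Real.rpow_natCast, ← Real.rpow_natCast, ← Real.rpow_mul (by norm_num),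
      ← Real.rpow_mul (by norm_num), mul_comm]
  have e2 : 2 * ((n + 1) * (c * h ^ β)) / (1 / 2) ^ (j + 1)
      = (4 * ((n : ℝ) + 1)) * (c * h ^ (β - 1)) := by
    rw [pow_succ, ← hh, Real.rpow_sub_one hpos.ne']
    field_simp
    ring
  have e3 : (h ^ (β - 1)) ^ k = h ^ ((β - 1) * k) := by
    rw [← Real.rpow_natCast, ← Real.rpow_mul hpos.le]
  rw [e1, e2, mul_pow, mul_pow c, e3, Real.mul_rpow hc.le (by positivity),
    ← Real.rpow_mul hpos.le, Real.rpow_sub hc, Real.rpow_sub hpos ((β - 1) * k),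
    Real.rpow_natCast, Real.rpow_neg hc.le, mul_neg, Real.rpow_neg hpos.le]
  ring

/-! ### Hölder separation by a random matrix -/

/-- With `β = 1/α`, the shell at distance about `2⁻ʲ` is covered at scale `η = c * 2 ^ (-jβ)` by at
most `η ^ (-d)` pieces, each bad with probability `O((2ʲ * η) ^ k)`. The bounds form a geometric
series with ratio `q`, and `q < 1` exactly when `d < (1 - α) * k`. The prefactor `c ^ (k - d)` makes
the sum small. -/
theorem exists_uniformMatrix_bad_le {n k : ℕ} {A : Set (Cube n)} {α : ℝ} (hα0 : 0 < α)
    {d : ℝ≥0} (hA : upperBoxDim A < d) (hd : d < (1 - α) * k) {δ : ℝ≥0∞} (hδ : 0 < δ) :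
    ∃ c : ℝ, 0 < c ∧ ∀ x : Cube n, uniformMatrix n k {L | L ∈ Set.Icc 0 1 ∧
      ∃ y ∈ A, dist (matrixApply L x) (matrixApply L y) < c * dist x y ^ (1 / α)} ≤ δ := by
  obtain ⟨ε₀, hε₀, hcov⟩ := coveringNumber_le_rpow_of_upperBoxDim_lt hA
  set β : ℝ := 1 / α with hβ
  have hβ0 : 0 < β := by positivity
  set q : ℝ := (1 / 2 : ℝ) ^ ((β - 1) * k - β * d) with hq
  have hq1 : q < 1 := by
    refine Real.rpow_lt_one (by norm_num) (by norm_num) ?_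
    have : (β - 1) * k - β * d = β * ((1 - α) * k - d) := by rw [hβ]; field_simp
    rw [this]
    exact mul_pos hβ0 (by linarith)
  have hkd : (0 : ℝ) < k - d := by
    have : (0 : ℝ) ≤ α * k := by positivity
    linarith
  set K : ℝ := (4 * ((n : ℝ) + 1)) ^ k
  set W : ℝ≥0∞ := (1 - ENNReal.ofReal q)⁻¹ with hW
  have hWtop : W ≠ ⊤ := by
    rw [hW, Ne, ENNReal.inv_eq_top, tsub_eq_zero_iff_le, not_le, ← ENNReal.ofReal_one]
    exact (ENNReal.ofReal_lt_ofReal_iff one_pos).2 hq1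
  have hlim : Tendsto (fun c : ℝ => ENNReal.ofReal (K * c ^ ((k : ℝ) - d)) * W) (𝓝[>] 0) (𝓝 0) := by
    have h1 : Tendsto (fun c : ℝ => K * c ^ ((k : ℝ) - d)) (𝓝[>] 0) (𝓝 (K * 0)) := by
      refine Tendsto.const_mul _ ?_
      have := (Real.continuousAt_rpow_const 0 ((k : ℝ) - d) (Or.inr hkd.le)).tendsto
      rw [Real.zero_rpow hkd.ne'] at this
      exact this.mono_left nhdsWithin_le_nhds
    have h2 := ENNReal.Tendsto.mul_const (ENNReal.tendsto_ofReal h1) (Or.inr hWtop)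
    simpa using h2
  obtain ⟨c, hcδ, hcε, hc⟩ := ((hlim.eventually (eventually_le_nhds hδ)).and
    ((eventually_nhdsWithin_of_eventually_nhds (eventually_lt_nhds hε₀)).and
      self_mem_nhdsWithin)).exists
  replace hc : 0 < c := hc
  refine ⟨c, hc, fun x => ?_⟩
  set η : ℕ → ℝ := fun j => c * ((1 / 2 : ℝ) ^ j) ^ β with hη
  have hηpos (j) : 0 < η j := by positivity
  have hηlt (j) : η j < ε₀ := by
    refine lt_of_le_of_lt ?_ hcε
    exact mul_le_of_le_one_right hc.le (Real.rpow_le_one (by positivity)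
      (pow_le_one₀ (by norm_num) (by norm_num)) hβ0.le)
  set E : ℕ → Set (Fin k → Fin n → ℝ) := fun j => {L | L ∈ Set.Icc 0 1 ∧
    ∃ y ∈ A, (1 / 2 : ℝ) ^ (j + 1) ≤ dist x y ∧
      dist (matrixApply L x) (matrixApply L y) < η j} with hE
  have hsub : {L : Fin k → Fin n → ℝ | L ∈ Set.Icc 0 1 ∧
      ∃ y ∈ A, dist (matrixApply L x) (matrixApply L y) < c * dist x y ^ β} ⊆ ⋃ j, E j := by
    rintro L ⟨hL, y, hy, hlt⟩
    -- The strict inequality excludes `y = x`, so the shells exhaust the bad event.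
    have hpos : 0 < dist x y := by
      refine dist_nonneg.lt_of_ne fun h => ?_
      rw [← h, Real.zero_rpow hβ0.ne', mul_zero] at hlt
      exact absurd hlt (not_lt.2 dist_nonneg)
    have hle : dist x y ≤ 1 := (dist_pi_le_iff zero_le_one).2 fun i => Real.dist_le_of_mem_Icc_01 (x i).2 (y i).2
    obtain ⟨j, h1, h2⟩ := exists_nat_pow_near_of_lt_one hpos hle (y := (1 / 2 : ℝ))
      (by norm_num) (by norm_num)
    refine Set.mem_iUnion.2 ⟨j, hL, y, hy, h1.le, hlt.trans_le ?_⟩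
    exact mul_le_mul_of_nonneg_left (Real.rpow_le_rpow hpos.le h2 hβ0.le) hc.le
  have hEj (j) : uniformMatrix n k (E j)
      ≤ ENNReal.ofReal (K * c ^ ((k : ℝ) - d)) * ENNReal.ofReal q ^ j := by
    refine (uniformMatrix_shell_le A x (by positivity) (hηpos j)).trans ?_
    rw [← ENNReal.ofReal_natCast, ← ENNReal.ofReal_pow (by positivity),
      ← ENNReal.ofReal_mul (by positivity), ← ENNReal.ofReal_pow (by positivity),
      ← ENNReal.ofReal_mul (by positivity), ← shell_bound_eq n k j hc]
    refine ENNReal.ofReal_le_ofReal ?_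
    gcongr
    exact hcov _ (hηpos j) (hηlt j)
  calc _ ≤ uniformMatrix n k (⋃ j, E j) := measure_mono hsub
    _ ≤ ∑' j, uniformMatrix n k (E j) := measure_iUnion_le _
    _ ≤ ∑' j, ENNReal.ofReal (K * c ^ ((k : ℝ) - d)) * ENNReal.ofReal q ^ j :=
        ENNReal.tsum_le_tsum hEj
    _ = ENNReal.ofReal (K * c ^ ((k : ℝ) - d)) * W := by
        rw [ENNReal.tsum_mul_left, ENNReal.tsum_geometric]
    _ ≤ δ := hcδ

/-! ### Construction of the code -/

/-- An `α`-Hölder map is Lipschitz for the snowflaked metric `dist ^ α`, so the inverse on `f '' K`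
extends coordinatewise by Lipschitz extension. Clamping to `[0,1]` is 1-Lipschitz and fixes the
prescribed values. -/
theorem exists_holderWith_leftInverse {X : Type*} [MetricSpace X] {n : ℕ} {α C : ℝ≥0} (hα0 : 0 < α)
    (hα1 : α ≤ 1) {K : Set (Cube n)} {f : Cube n → X}
    (h : ∀ x ∈ K, ∀ y ∈ K, dist x y ≤ C * dist (f x) (f y) ^ (α : ℝ)) :
    ∃ g : X → Cube n, HolderWith C α g ∧ ∀ x ∈ K, g (f x) = x := by
  have hα0' : (0 : ℝ) < α := hα0
  have hα1' : (α : ℝ) ≤ 1 := hα1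
  have hinj : Set.InjOn f K := fun x hx y hy hxy => by
    have := h x hx y hy
    rw [hxy, dist_self, Real.zero_rpow hα0'.ne', mul_zero] at this
    exact dist_le_zero.1 this
  let F : Metric.Snowflaking X α hα0' hα1' → Fin n → ℝ :=
    fun u i => Function.invFunOn f K u.ofSnowflaking i
  have hF (x) (hx : x ∈ K) : F (.toSnowflaking (f x)) = fun i => (x i : ℝ) := by
    simp only [F, Metric.Snowflaking.ofSnowflaking_toSnowflaking, hinj.leftInvOn_invFunOn hx]
  have hlip : LipschitzOnWith C F ((fun x => .toSnowflaking (f x)) '' K) := by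
    refine LipschitzOnWith.of_dist_le_mul ?_
    rintro _ ⟨x, hx, rfl⟩ _ ⟨y, hy, rfl⟩
    simp only [hF x hx, hF y hy, Metric.Snowflaking.dist_toSnowflaking_toSnowflaking]
    exact h x hx y hy
  obtain ⟨G, hG, hGF⟩ := hlip.extend_pi
  refine ⟨fun u i => Set.projIcc 0 1 zero_le_one (G (.toSnowflaking u) i), fun u v => ?_,
    fun x hx => ?_⟩
  · rw [← Metric.Snowflaking.edist_toSnowflaking_toSnowflaking (hα₀ := hα0') (hα₁ := hα1')]
    refine (edist_pi_le_iff.2 fun i => ?_).trans (hG _ _)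
    refine ((LipschitzWith.projIcc zero_le_one).edist_le_mul _ _).trans ?_
    rw [ENNReal.coe_one, one_mul]
    exact edist_le_pi_edist _ _ i
  · ext i
    have h1 : G (.toSnowflaking (f x)) i = x i := by
      rw [← hGF ⟨x, hx, rfl⟩, hF x hx]
    simp only [h1, Set.projIcc_val]

theorem exists_linear_holder_code {n k : ℕ} (hn : 0 < n) {A : Set (Cube n)} {α : ℝ≥0}
    (hα0 : 0 < α) (hα1 : α ≤ 1) {d : ℝ≥0} (hA : upperBoxDim A < d)
    (hd : (d : ℝ) < (1 - α) * k) (ν : Measure (Cube n)) [IsProbabilityMeasure ν] {δ : ℝ≥0∞}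
    (hδ : 0 < δ) :
    ∃ f ∈ LIN n k, ∃ g ∈ Hoelder α k n, ν {x | x ∈ A ∧ g (f x) ≠ x} ≤ δ := by
  have hα0' : (0 : ℝ) < α := hα0
  have hn' : (0 : ℝ) < n := by exact_mod_cast hn
  obtain ⟨c, hc, hbad⟩ := exists_uniformMatrix_bad_le hα0' hA hd hδ
  set O : Set (Cube n × (Fin k → Fin n → ℝ)) := {p | ∃ y ∈ A,
    dist (matrixApply p.2 p.1) (matrixApply p.2 y) < c * dist p.1 y ^ (1 / (α : ℝ))} with hO
  -- Openness supplies the measurability Fubini needs, although the union over `y ∈ A` may be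
  -- uncountable.
  have hOopen : IsOpen O := by
    have : O = ⋃ y ∈ A, {p | dist (matrixApply p.2 p.1) (matrixApply p.2 y)
        < c * dist p.1 y ^ (1 / (α : ℝ))} := by
      ext p; simp [hO]
    rw [this]
    refine isOpen_biUnion fun y _ => isOpen_lt ?_ ?_
    · exact (continuous_matrixApply.comp (continuous_snd.prodMk continuous_fst)).dist
        (continuous_matrixApply.comp (continuous_snd.prodMk continuous_const))
    · exact continuous_const.mul
        ((continuous_fst.dist continuous_const).rpow_const fun _ => Or.inr (by positivity))
  have hfiber (x : Cube n) : uniformMatrix n k (Prod.mk x ⁻¹' O) ≤ δ := by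
    refine le_trans ?_ (hbad x)
    rw [← measure_inter_conull (uniformMatrix_compl_unitBox n k)]
    exact measure_mono fun L hL => ⟨hL.2, hL.1⟩
  have hprod : ∫⁻ L, ν ((fun x => (x, L)) ⁻¹' O) ∂uniformMatrix n k ≤ δ := by
    rw [← Measure.prod_apply_symm hOopen.measurableSet, Measure.prod_apply hOopen.measurableSet]
    calc _ ≤ ∫⁻ _, δ ∂ν := lintegral_mono hfiber
      _ = δ := by simp
  obtain ⟨L, hLbox, hL⟩ := exists_notMem_null_le_lintegral
    (measurable_measure_prodMk_right hOopen.measurableSet).aemeasurable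
    (uniformMatrix_compl_unitBox n k) (f := fun L => ν ((fun x => (x, L)) ⁻¹' O))
  rw [Set.mem_compl_iff, not_not] at hLbox
  have hnn (x : Cube n) (j) : 0 ≤ matrixApply L x j :=
    Finset.sum_nonneg fun i _ => mul_nonneg (hLbox.1 j i) (x i).2.1
  have hlen (x : Cube n) (j) : matrixApply L x j ≤ n := by
    calc matrixApply L x j ≤ ∑ _i : Fin n, (1 : ℝ) := Finset.sum_le_sum fun i _ =>
          mul_le_one₀ (hLbox.2 j i) (x i).2.1 (x i).2.2
      _ = n := by simp
  -- Entries in `[0,1]` give row sums in `[0,n]`; dividing by `n` lands in the cube.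
  let f : Cube n → Cube k := fun x j =>
    ⟨matrixApply L x j / n, div_nonneg (hnn x j) hn'.le, (div_le_one hn').2 (hlen x j)⟩
  have hdist (x y) : dist (matrixApply L x) (matrixApply L y) ≤ n * dist (f x) (f y) := by
    refine (dist_pi_le_iff (by positivity)).2 fun j => ?_
    have h1 := dist_le_pi_dist (f x) (f y) j
    rw [Subtype.dist_eq, Real.dist_eq, ← sub_div, abs_div, abs_of_pos hn', div_le_iff₀ hn'] at h1
    rw [Real.dist_eq]
    linarith
  have hK : ∀ x ∈ {x | x ∈ A ∧ (x, L) ∉ O}, ∀ y ∈ {x | x ∈ A ∧ (x, L) ∉ O},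
      dist x y ≤ (Real.toNNReal ((n / c) ^ (α : ℝ)) : ℝ) * dist (f x) (f y) ^ (α : ℝ) := by
    rintro x ⟨-, hx⟩ y ⟨hy, -⟩
    rw [Real.coe_toNNReal _ (by positivity), ← Real.mul_rpow (by positivity) dist_nonneg]
    have h1 : c * dist x y ^ (1 / (α : ℝ)) ≤ n * dist (f x) (f y) :=
      (not_lt.1 fun h => hx ⟨y, hy, h⟩).trans (hdist x y)
    have h2 : dist x y ^ (1 / (α : ℝ)) ≤ n / c * dist (f x) (f y) := by
      rw [div_mul_eq_mul_div, le_div_iff₀ hc]; linarith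
    calc dist x y = (dist x y ^ (1 / (α : ℝ))) ^ (α : ℝ) := by
          rw [← Real.rpow_mul dist_nonneg, one_div_mul_cancel hα0'.ne', Real.rpow_one]
      _ ≤ _ := Real.rpow_le_rpow (by positivity) h2 hα0'.le
  obtain ⟨g, hg, hgf⟩ := exists_holderWith_leftInverse hα0 hα1 hK
  refine ⟨f, ⟨(n : ℝ)⁻¹ • Matrix.toLin' (Matrix.of L), fun x => ?_⟩, g, ⟨_, hg⟩, ?_⟩
  · ext j
    simp [f, matrixApply, Matrix.mulVec, dotProduct, div_eq_inv_mul]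
  · refine (measure_mono fun x hx => ?_).trans (hL.trans hprod)
    by_contra h
    exact hx.2 (hgf x ⟨hx.1, h⟩)

/-! ### From codes to rates -/

theorem measurable_block (n : ℕ) : Measurable (block n) :=
  measurable_pi_lambda _ fun _ => measurable_pi_apply _

theorem blockCompressionRate_le {S : Set Traj} {μ : Measure Traj} [IsProbabilityMeasure μ]
    {α : ℝ≥0} (hα0 : 0 < α) (hα1 : α < 1) {ε : ℝ≥0} (hε : 0 < ε) {n : ℕ} (hn : 0 < n)
    {A : Set (Cube n)} (hA : IsCompact A)
    (hμA : 1 - ((ε / 2 : ℝ≥0) : ℝ≥0∞) ≤ μ (block n ⁻¹' A)) :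
    blockCompressionRate LIN (Hoelder α) S μ ε n
      ≤ 1 / (1 - (α : ℝ≥0∞)) * (upperBoxDim A / n) + 1 / n := by
  have hα1' : (α : ℝ) < 1 := hα1
  have hα2 : (0 : ℝ) < 1 - α := by linarith
  have hcoe : (1 : ℝ≥0∞) - α = ((1 - α : ℝ≥0) : ℝ≥0∞) := by rw [ENNReal.coe_sub, ENNReal.coe_one]
  have hne : (1 - α : ℝ≥0) ≠ 0 := (tsub_pos_of_lt hα1).ne'
  have hsub : ((1 - α : ℝ≥0) : ℝ) = 1 - α := by rw [NNReal.coe_sub hα1.le, NNReal.coe_one]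
  rcases eq_or_ne (upperBoxDim A) ⊤ with htop | htop
  · rw [htop, ENNReal.top_div_of_ne_top (ENNReal.natCast_ne_top n), ENNReal.mul_top, top_add]
    · exact le_top
    · rw [hcoe]; simp
  obtain ⟨D, hD⟩ : ∃ D : ℝ≥0, (D : ℝ≥0∞) = upperBoxDim A := ⟨_, ENNReal.coe_toNNReal htop⟩
  -- The `+ 1` makes `D < (1 - α) * k` strict, leaving room for `d`; it costs `1 / n` in the rate.
  set k : ℕ := ⌊D / (1 - α)⌋₊ + 1 with hk
  have hDk : D < (1 - α) * k := by
    have := Nat.lt_floor_add_one (D / (1 - α))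
    rw [div_lt_iff₀ (tsub_pos_of_lt hα1), mul_comm] at this
    rw [hk]; exact_mod_cast this
  obtain ⟨d, hDd, hdk⟩ := exists_between hDk
  have : IsProbabilityMeasure (μ.map (block n)) :=
    Measure.isProbabilityMeasure_map (measurable_block n).aemeasurable
  have hε2 : (0 : ℝ≥0∞) < ((ε / 2 : ℝ≥0) : ℝ≥0∞) := ENNReal.coe_pos.2 (half_pos hε)
  obtain ⟨f, hf, g, hg, hfg⟩ := exists_linear_holder_code hn hα0 hα1.le (k := k)
    (show upperBoxDim A < d by rw [← hD]; exact_mod_cast hDd)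
    (by rw [← hsub]; exact_mod_cast hdk) (μ.map (block n)) hε2
  have hcompl : μ (block n ⁻¹' Aᶜ) ≤ ((ε / 2 : ℝ≥0) : ℝ≥0∞) := by
    rw [Set.preimage_compl, prob_compl_eq_one_sub (measurable_block n hA.measurableSet)]
    exact tsub_le_iff_tsub_le.1 hμA
  -- Half of the error budget pays for blocks outside `A`, half for decoding failures inside it.
  have hgood : μ {x | x ∈ S ∧ g (f (block n x)) ≠ block n x} ≤ (ε : ℝ≥0∞) := by
    calc _ ≤ μ (block n ⁻¹' Aᶜ ∪ block n ⁻¹' {x | x ∈ A ∧ g (f x) ≠ x}) := by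
          refine measure_mono fun x hx => ?_
          by_cases h : block n x ∈ A
          · exact Or.inr ⟨h, hx.2⟩
          · exact Or.inl h
      _ ≤ ((ε / 2 : ℝ≥0) : ℝ≥0∞) + ((ε / 2 : ℝ≥0) : ℝ≥0∞) := (measure_union_le _ _).trans
          (add_le_add hcompl
            ((Measure.le_map_apply (measurable_block n).aemeasurable _).trans hfg))
      _ = ε := by rw [← ENNReal.coe_add, add_halves]
  refine (iInf₂_le k ⟨f, hf, g, hg, hgood⟩).trans ?_
  rw [← mul_div_assoc, ← ENNReal.add_div]
  gcongr
  rw [← hD, hcoe, one_div, ← ENNReal.coe_inv hne]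
  have : (k : ℝ≥0) ≤ (1 - α)⁻¹ * D + 1 := by
    rw [hk, Nat.cast_add, Nat.cast_one, mul_comm, ← div_eq_mul_inv]
    gcongr
    exact Nat.floor_le zero_le
  exact_mod_cast this

theorem compressionRate_le {S : Set Traj} {μ : Measure Traj} (hμ : μ ∈ invariantMeasures S)
    {α : ℝ≥0} (hα0 : 0 < α) (hα1 : α < 1) {ε : ℝ≥0} (hε : 0 < ε) :
    compressionRate LIN (Hoelder α) S μ ε
      ≤ 1 / (1 - (α : ℝ≥0∞)) * measurableMeanBoxDim μ (ε / 2) := by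
  have := hμ.1
  have hb0 : 1 / (1 - (α : ℝ≥0∞)) ≠ 0 := by
    rw [one_div]
    exact ENNReal.inv_ne_zero.2 (ENNReal.sub_ne_top ENNReal.one_ne_top)
  have hbtop : 1 / (1 - (α : ℝ≥0∞)) ≠ ⊤ := by
    rw [one_div, Ne, ENNReal.inv_eq_top, tsub_eq_zero_iff_le, not_le]
    exact_mod_cast hα1
  have hlim : Tendsto (fun n : ℕ => 1 / (n : ℝ≥0∞)) atTop (𝓝 0) := by
    simpa only [one_div] using ENNReal.tendsto_inv_nat_nhds_zero
  rw [measurableMeanBoxDim, ← ENNReal.limsup_const_mul_of_ne_top hbtop,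
    ← ENNReal.limsup_add_of_right_tendsto_zero hlim]
  refine limsup_le_limsup ?_
  filter_upwards [eventually_gt_atTop 0] with n hn
  -- Moving `1 / n` to the left lets the bound pass to the infimum over `A`.
  refine tsub_le_iff_right.1 ?_
  beta_reduce
  rw [ENNReal.mul_iInf_of_ne hb0 hbtop]
  refine le_iInf fun A => ?_
  rw [ENNReal.mul_iInf_of_ne hb0 hbtop]
  refine le_iInf fun hA => tsub_le_iff_right.2 ?_
  exact blockCompressionRate_le hα0 hα1 hε hn hA.1 hA.2

end AnalogCompression

theorem mainTheorem5 (S : Set AnalogCompression.Traj) (hS : AnalogCompression.IsSubshift S)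
    (α : ℝ≥0) (hα0 : 0 < α) (hα1 : α < 1) :
    (α : ℝ≥0∞) *
        (⨆ (ε : ℝ≥0) (_ : 0 < ε), ⨆ μ ∈ AnalogCompression.invariantMeasures S,
          AnalogCompression.measurableMeanBoxDim μ ε)
      ≤ (⨆ (ε : ℝ≥0) (_ : 0 < ε), ⨆ μ ∈ AnalogCompression.invariantMeasures S,
          AnalogCompression.compressionRate AnalogCompression.LIN
            (AnalogCompression.Hoelder α) S μ ε) ∧
    (⨆ (ε : ℝ≥0) (_ : 0 < ε), ⨆ μ ∈ AnalogCompression.invariantMeasures S,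
          AnalogCompression.compressionRate AnalogCompression.LIN
            (AnalogCompression.Hoelder α) S μ ε)
      ≤ (1 / (1 - (α : ℝ≥0∞))) *
        (⨆ (ε : ℝ≥0) (_ : 0 < ε), ⨆ μ ∈ AnalogCompression.invariantMeasures S,
          AnalogCompression.measurableMeanBoxDim μ ε) := by
  constructor
  · simp only [ENNReal.mul_iSup]
    exact iSup₂_mono fun ε _ => iSup₂_mono fun μ hμ =>
      AnalogCompression.mul_measurableMeanBoxDim_le_compressionRate hμ hα0 ε _
  · refine iSup₂_le fun ε hε => iSup₂_le fun μ hμ => ?_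
    refine (AnalogCompression.compressionRate_le hμ hα0 hα1 hε).trans ?_
    gcongr
    -- The loss from `ε` to `ε / 2` is absorbed by the supremum over positive errors.
    refine le_iSup₂_of_le (ε / 2) (half_pos hε) (le_iSup₂_of_le μ hμ le_rfl)
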